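/- Let $\mathbb K\in\{\mathbb R,\mathbb C\}$, let $J,R,Q\in\mathbb K^{n\times n}$, $B\in\mathbb K^{n\times m}$, $S\in\mathbb K^{m\times m}$ with $J=-J^H$, $R=R^H\ge 0$, $Q=Q^H\ge 0$, $S=S^H\ge 0$, let $t_0<t_1$ be real and $x^0,x^1\in\mathbb K^n$. Consider the optimal control problem $$\min_{u\in L^1([t_0,t_1],\mathbb K^m)}\ \frac12\int_{t_0}^{t_1}\big[x(t)^HQRQ\,x(t)+u(t)^HS\,u(t)\big]\,dt$$ subject to $x\in W^{1,1}([t_0,t_1],\mathbb K^n)$, $x'(t)=(J-R)Q\,x(t)+Bu(t)$ for a.e. $t\in[t_0,t_1]$, $x(t_0)=x^0$, $x(t_1)=x^1$ (the cost takes values in $[0,\infty]$). Put $$\mathcal E=\begin{bmatrix}0&I_n&0\\-I_n&0&0\\0&0&0_{m\times m}\end{bmatrix},\qquad \mathcal A_S=\begin{bmatrix}0&(J-R)Q&B\\((J-R)Q)^H&QRQ&0\\B^H&0&S\end{bmatrix}.$$ Assume that the pencil $s\mathcal E-\mathcal A_S$ is regular, and let $\mu\in\mathbb K\setminus\big(\sigma((J-R)Q)\cup\sigma(-((J-R)Q)^H)\big)$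 be such that $\mu\mathcal E-\mathcal A_S$ is invertible. Define $$E_\mu=\begin{bmatrix}0&(J-R)Q-\mu I\\((J-R)Q)^H+\mu I&QRQ\end{bmatrix}^{-1},\qquad S_\mu=S-\begin{bmatrix}B^H&0\end{bmatrix}E_\mu\begin{bmatrix}B\\0\end{bmatrix},$$ $$N_\mu=\Big(E_\mu+E_\mu\begin{bmatrix}B\\0\end{bmatrix}S_\mu^{-1}\begin{bmatrix}B^H&0\end{bmatrix}E_\mu\Big)\begin{bmatrix}0&-I\\I&0\end{bmatrix},\qquad M_\mu=-S_\mu^{-1}\begin{bmatrix}B^H&0\end{bmatrix}E_\mu\begin{bmatrix}0&-I\\I&0\end{bmatrix}$$ ($S_\mu$ is then invertible). Let $N_\mu^D$ be the Drazin inverse of $N_\mu$, that is, the unique matrix with $N_\mu^DN_\mu=N_\mu N_\mu^D$, $N_\mu^DN_\mu N_\mu^D=N_\mu^D$ and $N_\mu^DN_\mu^{\nu+1}=N_\mu^\nu$ for some $\nu\in\mathbb N_0$, and write, with blocks of size $n\times n$, $$\exp\big(-N_\mu^D(I-\mu N_\mu)(t-t_0)\big)=\begin{bmatrix}E_1(t)&E_2(t)\\E_3(t)&E_4(t)\end{bmatrix},\qquad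 t\in\mathbb R.$$ Assume that $E_3(t_1)$ is invertible and that $$w^0:=\begin{bmatrix}E_3(t_1)^{-1}[x^1-E_4(t_1)x^0]\\x^0\end{bmatrix}\in\mathrm{im}\,(N_\mu^DN_\mu).$$ Then the control $$u(t)=M_\mu N_\mu^D\exp\big(-N_\mu^D(I-\mu N_\mu)(t-t_0)\big)\,w^0,\qquad t\in[t_0,t_1],$$ is optimal, and it is the unique optimal control: every optimal control coincides with $u$ almost everywhere on $[t_0,t_1]$. -/

import Mathlib

open MeasureTheory Set Matrix
open scoped ComplexOrder

namespace PHOCP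

/-! ### Drazin inverse -/

section Drazin

variable {ι : Type*} [Fintype ι] [DecidableEq ι] {𝕜 : Type*} [Field 𝕜]

/-- `D` is a Drazin inverse of the square matrix `M`. -/
structure IsDrazinInverse (M D : Matrix ι ι 𝕜) : Prop where
  comm : D * M = M * D
  outer : D * M * D = D
  index : ∃ ν : ℕ, D * M ^ (ν + 1) = M ^ ν

theorem exists_isDrazinInverse (M : Matrix ι ι 𝕜) : ∃ D, IsDrazinInverse M D := by
  obtain ⟨g, hg, hX⟩ := Polynomial.exists_eq_pow_rootMultiplicity_mul_and_not_dvd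
    M.charpoly M.charpoly_monic.ne_zero 0
  set k := M.charpoly.rootMultiplicity 0 with hk
  rw [map_zero, sub_zero] at hg hX
  have hc : g.coeff 0 ≠ 0 := fun h => hX (Polynomial.X_dvd_iff.mpr h)
  have h0 : M ^ k * Polynomial.aeval M g = 0 := by
    have h := M.aeval_self_charpoly
    rw [hg, map_mul, map_pow, Polynomial.aeval_X] at h
    exact h
  have hdec : Polynomial.aeval M g
      = M * Polynomial.aeval M g.divX + algebraMap 𝕜 (Matrix ι ι 𝕜) (g.coeff 0) := by
    have h := congrArg (Polynomial.aeval M) (Polynomial.X_mul_divX_add g)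
    rw [map_add, map_mul, Polynomial.aeval_X, Polynomial.aeval_C] at h
    exact h.symm
  set P : Matrix ι ι 𝕜 := (-(g.coeff 0)⁻¹) • Polynomial.aeval M g.divX with hP
  have hMP : Commute M P := by
    have h : Commute M (Polynomial.aeval M g.divX) := by
      have h := (Commute.all Polynomial.X g.divX).map (Polynomial.aeval M)
      rwa [Polynomial.aeval_X] at h
    exact h.smul_right _
  have hkP : M ^ (k + 1) * P = M ^ k := by
    rw [hdec, mul_add, ← mul_assoc, ← pow_succ, Algebra.algebraMap_eq_smul_one,
      mul_smul_comm, mul_one] at h0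
    have h1 : M ^ (k + 1) * Polynomial.aeval M g.divX = -(g.coeff 0 • M ^ k) :=
      eq_neg_of_add_eq_zero_left h0
    rw [hP, mul_smul_comm, h1, smul_neg, neg_smul, neg_neg, smul_smul, inv_mul_cancel₀ hc,
      one_smul]
  have hstep : ∀ j : ℕ, M ^ (k + j) * P ^ j = M ^ k := by
    intro j
    induction j with
    | zero => simp
    | succ j ih =>
      calc M ^ (k + (j + 1)) * P ^ (j + 1)
          = M ^ j * (M ^ (k + 1) * P) * P ^ j := by
            rw [pow_succ' P j, show k + (j + 1) = j + (k + 1) by ring, pow_add M j (k + 1)]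
            simp only [mul_assoc]
        _ = M ^ (k + j) * P ^ j := by rw [hkP, ← pow_add, add_comm]
        _ = M ^ k := ih
  have hc1 : ∀ a b : ℕ, P ^ a * M ^ b = M ^ b * P ^ a := fun a b =>
    ((hMP.pow_pow b a).eq).symm
  refine ⟨M ^ k * P ^ (k + 1), ⟨?_, ?_, ⟨k, ?_⟩⟩⟩
  · have := hc1 (k + 1) 1
    rw [pow_one] at this
    rw [mul_assoc, this, ← mul_assoc, ← mul_assoc, ← pow_succ, ← pow_succ']
  · have h := hc1 (k + 1) 1
    rw [pow_one] at h
    calc M ^ k * P ^ (k + 1) * M * (M ^ k * P ^ (k + 1))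
        = M ^ k * (P ^ (k + 1) * M ^ (k + 1)) * P ^ (k + 1) := by
          rw [pow_succ' M k]; simp only [mul_assoc]
      _ = M ^ (k + (k + 1)) * P ^ (k + 1) * P ^ (k + 1) := by
          rw [hc1, pow_add M k (k + 1)]; simp only [mul_assoc]
      _ = M ^ k * P ^ (k + 1) := by rw [hstep]
  · rw [mul_assoc, hc1, ← mul_assoc, ← pow_add, hstep]

theorem IsDrazinInverse.mul_eq {M X Y : Matrix ι ι 𝕜}
    (hX : IsDrazinInverse M X) (hY : IsDrazinInverse M Y) :
    Y * M * (X * M) = X * M ∧ X * M * (Y * M) = X * M := by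
  obtain ⟨ν, hν⟩ := hY.index
  have hcX : Commute X M := hX.comm
  have hcY : Commute Y M := hY.comm
  have hidem : ∀ j : ℕ, (X * M) ^ (j + 1) = X * M := by
    intro j
    induction j with
    | zero => simp
    | succ j ih => rw [pow_succ, ih, ← mul_assoc, hX.outer]
  have he' : X * M = X ^ (ν + 1) * M ^ (ν + 1) := by
    rw [← hcX.mul_pow, hidem ν]
  have he : X * M = M ^ (ν + 1) * X ^ (ν + 1) := by
    rw [he', (hcX.pow_pow _ _).eq]
  have h : Y * M * M ^ (ν + 1) = M ^ (ν + 1) := by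
    calc Y * M * M ^ (ν + 1) = Y * M ^ (ν + 1) * M := by
          rw [mul_assoc, mul_assoc, ← pow_succ', ← pow_succ]
      _ = M ^ (ν + 1) := by rw [hν, ← pow_succ]
  have h' : M ^ (ν + 1) * (Y * M) = M ^ (ν + 1) := by
    have hc : Commute (Y * M) M := hcY.mul_left (Commute.refl M)
    rw [← (hc.pow_right (ν + 1)).eq, h]
  constructor
  · rw [he, ← mul_assoc, h]
  · rw [he', mul_assoc, h']

theorem IsDrazinInverse.unique {M X Y : Matrix ι ι 𝕜}
    (hX : IsDrazinInverse M X) (hY : IsDrazinInverse M Y) : X = Y := by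
  have he : X * M = Y * M := by
    rw [← (hX.mul_eq hY).2, (hY.mul_eq hX).1]
  calc X = Y * M * X := by rw [← he, hX.outer]
    _ = Y * (Y * M) := by rw [mul_assoc, ← hX.comm, he]
    _ = Y := by rw [hY.comm, ← mul_assoc, hY.outer]

/-- The Drazin inverse `M^D` of a square matrix `M`. -/
noncomputable def drazin (M : Matrix ι ι 𝕜) : Matrix ι ι 𝕜 :=
  Classical.choose (exists_isDrazinInverse M)

theorem drazin_spec (M : Matrix ι ι 𝕜) : IsDrazinInverse M (drazin M) :=
  Classical.choose_spec (exists_isDrazinInverse M)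

end Drazin

/-! ### Port-Hamiltonian data, the optimality pencil and the derived matrices -/

section Pencil

variable {n m : ℕ} {𝕜 : Type*} [RCLike 𝕜]

/-- Structural conditions on `J`, `R`, `Q` in a linear port-Hamiltonian system
`x' = (J - R) Q x + B u`: `J` is skew-Hermitian, `R` and `Q` are Hermitian and positive
semidefinite. -/
structure IsPortHamiltonian (J R Q : Matrix (Fin n) (Fin n) 𝕜) : Prop where
  skew : Jᴴ = -J
  dissipation : R.PosSemidef
  energy : Q.PosSemidef

/-- The leading matrix `[[0, I, 0], [-I, 0, 0], [0, 0, 0]]` of the optimality pencil. -/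
def pencilE (n m : ℕ) (𝕜 : Type*) [RCLike 𝕜] :
    Matrix ((Fin n ⊕ Fin n) ⊕ Fin m) ((Fin n ⊕ Fin n) ⊕ Fin m) 𝕜 :=
  fromBlocks (fromBlocks 0 1 (-1) 0) 0 0 0

/-- The matrix `[[0, (J-R)Q, B], [((J-R)Q)ᴴ, QRQ, 0], [Bᴴ, 0, S]]` of the optimality pencil. -/
def pencilA (J R Q : Matrix (Fin n) (Fin n) 𝕜) (B : Matrix (Fin n) (Fin m) 𝕜)
    (S : Matrix (Fin m) (Fin m) 𝕜) :
    Matrix ((Fin n ⊕ Fin n) ⊕ Fin m) ((Fin n ⊕ Fin n) ⊕ Fin m) 𝕜 :=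
  fromBlocks (fromBlocks 0 ((J - R) * Q) ((J - R) * Q)ᴴ (Q * R * Q))
    (fromRows B 0) (fromCols Bᴴ 0) S

/-- `E_μ = [[0, (J-R)Q - μI], [((J-R)Q)ᴴ + μI, QRQ]]⁻¹`. -/
noncomputable def Emu (J R Q : Matrix (Fin n) (Fin n) 𝕜) (μ : 𝕜) :
    Matrix (Fin n ⊕ Fin n) (Fin n ⊕ Fin n) 𝕜 :=
  (fromBlocks 0 ((J - R) * Q - μ • 1) (((J - R) * Q)ᴴ + μ • 1) (Q * R * Q))⁻¹

/-- `S_μ = S - [Bᴴ, 0] E_μ [B; 0]`. -/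
noncomputable def Smu (J R Q : Matrix (Fin n) (Fin n) 𝕜) (B : Matrix (Fin n) (Fin m) 𝕜)
    (S : Matrix (Fin m) (Fin m) 𝕜) (μ : 𝕜) : Matrix (Fin m) (Fin m) 𝕜 :=
  S - (fromCols Bᴴ 0 : Matrix (Fin m) (Fin n ⊕ Fin n) 𝕜) * Emu J R Q μ
    * (fromRows B 0 : Matrix (Fin n ⊕ Fin n) (Fin m) 𝕜)

/-- The symplectic unit `[[0, -I], [I, 0]]`. -/
def symp (n : ℕ) (𝕜 : Type*) [RCLike 𝕜] : Matrix (Fin n ⊕ Fin n) (Fin n ⊕ Fin n) 𝕜 :=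
  fromBlocks 0 (-1) 1 0

/-- `N_μ = (E_μ + E_μ [B; 0] S_μ⁻¹ [Bᴴ, 0] E_μ) [[0, -I], [I, 0]]`. -/
noncomputable def Nmu (J R Q : Matrix (Fin n) (Fin n) 𝕜) (B : Matrix (Fin n) (Fin m) 𝕜)
    (S : Matrix (Fin m) (Fin m) 𝕜) (μ : 𝕜) : Matrix (Fin n ⊕ Fin n) (Fin n ⊕ Fin n) 𝕜 :=
  (Emu J R Q μ + Emu J R Q μ * (fromRows B 0 : Matrix (Fin n ⊕ Fin n) (Fin m) 𝕜)
    * (Smu J R Q B S μ)⁻¹ * (fromCols Bᴴ 0 : Matrix (Fin m) (Fin n ⊕ Fin n) 𝕜)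
    * Emu J R Q μ) * symp n 𝕜

/-- `M_μ = -S_μ⁻¹ [Bᴴ, 0] E_μ [[0, -I], [I, 0]]`. -/
noncomputable def Mmu (J R Q : Matrix (Fin n) (Fin n) 𝕜) (B : Matrix (Fin n) (Fin m) 𝕜)
    (S : Matrix (Fin m) (Fin m) 𝕜) (μ : 𝕜) : Matrix (Fin m) (Fin n ⊕ Fin n) 𝕜 :=
  -((Smu J R Q B S μ)⁻¹ * (fromCols Bᴴ 0 : Matrix (Fin m) (Fin n ⊕ Fin n) 𝕜)
    * Emu J R Q μ * symp n 𝕜)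

/-- The matrix exponential `exp(-N^D (I - μ N) τ)`, for a square matrix `N`, a scalar `μ` and an
elapsed time `τ`. -/
noncomputable def flow (N : Matrix (Fin n ⊕ Fin n) (Fin n ⊕ Fin n) 𝕜) (μ : 𝕜) (τ : ℝ) :
    Matrix (Fin n ⊕ Fin n) (Fin n ⊕ Fin n) 𝕜 :=
  NormedSpace.exp (τ • (-(drazin N * (1 - μ • N))))

end Pencil

/-! ### The optimal control problem -/

section OCP

variable {n m : ℕ} {𝕜 : Type*} [RCLike 𝕜]

/-- The pair `(x, u)` is admissible on `[t₀, t₁]`: `x` is absolutely continuous, `u` is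
integrable, `x' = (J - R) Q x + B u` almost everywhere (so that `x'` is integrable), and
`x t₀ = x₀`, `x t₁ = x₁`. -/
structure IsAdmissible (J R Q : Matrix (Fin n) (Fin n) 𝕜) (B : Matrix (Fin n) (Fin m) 𝕜)
    (t₀ t₁ : ℝ) (x₀ x₁ : Fin n → 𝕜) (x : ℝ → Fin n → 𝕜) (u : ℝ → Fin m → 𝕜) : Prop where
  state_ac : AbsolutelyContinuousOnInterval x t₀ t₁
  control_integrable : IntegrableOn u (Icc t₀ t₁)
  dynamics : ∀ᵐ t ∂(volume.restrict (Icc t₀ t₁)),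
    HasDerivAt x (((J - R) * Q) *ᵥ x t + B *ᵥ u t) t
  initial : x t₀ = x₀
  terminal : x t₁ = x₁

/-- The cost `½ ∫ (xᴴ Q R Q x + uᴴ S u) dt` over `[t₀, t₁]`. For `R, S ≥ 0` the integrand is real
and nonnegative, and the integral is taken in `[0, ∞]`, since it may diverge for a control that
is merely integrable. -/
noncomputable def cost (R Q : Matrix (Fin n) (Fin n) 𝕜) (S : Matrix (Fin m) (Fin m) 𝕜)
    (t₀ t₁ : ℝ) (x : ℝ → Fin n → 𝕜) (u : ℝ → Fin m → 𝕜) : ENNReal :=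
  ∫⁻ t in Icc t₀ t₁, ENNReal.ofReal
    ((1 / 2 : ℝ) * RCLike.re (star (x t) ⬝ᵥ ((Q * R * Q) *ᵥ x t) + star (u t) ⬝ᵥ (S *ᵥ u t)))

/-- `u` is an optimal control: with some state trajectory it is admissible and its cost is
minimal among all admissible pairs. -/
def IsOptimalControl (J R Q : Matrix (Fin n) (Fin n) 𝕜) (B : Matrix (Fin n) (Fin m) 𝕜)
    (S : Matrix (Fin m) (Fin m) 𝕜) (t₀ t₁ : ℝ) (x₀ x₁ : Fin n → 𝕜) (u : ℝ → Fin m → 𝕜) : Prop :=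
  ∃ x : ℝ → Fin n → 𝕜, IsAdmissible J R Q B t₀ t₁ x₀ x₁ x u ∧
    ∀ (x' : ℝ → Fin n → 𝕜) (u' : ℝ → Fin m → 𝕜), IsAdmissible J R Q B t₀ t₁ x₀ x₁ x' u' →
      cost R Q S t₀ t₁ x u ≤ cost R Q S t₀ t₁ x' u'

end OCP

end PHOCP

/-! The problem is convex, so Pontryagin's conditions are sufficient. Write `A = (J - R)Q`, `P =
QRQ`, and let `l` be the multiplier. The optimality system is `x' = Ax + Bu`, `l' = -(Aᴴl + Px)`,
`Bᴴl + Su = 0`. For `z = (l, x)`, block elimination with the Schur complement `S_μ` turns it into `z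
= -N(z' - μz)`, `u = -M(z' - μz)` (`optimality_system_iff`). On the image of `N^D N` the equation
for `z` is solved by the flow in the theorem, where `z' - μz = -N^D z` and hence `u = M N^D z`
(`flow_mulVec_spec`); the choice of `w₀` meets both boundary conditions.

Optimality (`cost_comparison`): expanding the cost of a competitor around `(x, u)` leaves the cost
of the difference, which is nonnegative, and a cross term. By the adjoint equations the cross term
is minus the derivative of `Re((x' - x)ᴴ l)`, where `x'` now denotes the competing state. This
pairing vanishes at both ends, so the cross term integrates to zero.

Uniqueness (`control_ae_eq_of_regular`): equal cost forces `P(x' - x) = 0` and `S(u' - u) = 0`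
almost everywhere. The differences then solve the optimality system with zero multiplier and zero
initial value, and a linear differential-algebraic equation with zero initial value has only the
zero solution (`eq_zero_of_linear_dae`). Hence `u' = u` almost everywhere. -/

namespace PHOCP

/-! ### Closure properties of absolutely continuous vector functions. -/

section AbsolutelyContinuous

variable {X Y F : Type*} [PseudoMetricSpace X] [PseudoMetricSpace Y] [SeminormedAddCommGroup F]
variable {ι κ : Type*} [Fintype ι] [Fintype κ] {𝕜 : Type*} [RCLike 𝕜] {a b : ℝ}

theorem absolutelyContinuousOnInterval_comp_lipschitz {K : NNReal} {g : X → Y} {f : ℝ → X}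
    (hg : LipschitzWith K g) (hf : AbsolutelyContinuousOnInterval f a b) :
    AbsolutelyContinuousOnInterval (fun t => g (f t)) a b := by
  apply squeeze_zero (fun t => Finset.sum_nonneg fun i _ => dist_nonneg) (fun t => ?_)
    (by simpa using Filter.Tendsto.const_mul (K : ℝ) hf)
  rw [Finset.mul_sum]
  exact Finset.sum_le_sum fun i _ => hg.dist_le_mul _ _

theorem absolutelyContinuousOnInterval_clm {E G : Type*} [NormedAddCommGroup E]
    [NormedAddCommGroup G] [NormedSpace ℝ E] [NormedSpace ℝ G] (g : E →L[ℝ] G) {f : ℝ → E}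
    (hf : AbsolutelyContinuousOnInterval f a b) :
    AbsolutelyContinuousOnInterval (fun t => g (f t)) a b :=
  absolutelyContinuousOnInterval_comp_lipschitz g.lipschitz hf

theorem absolutelyContinuousOnInterval_const (c : X) :
    AbsolutelyContinuousOnInterval (fun _ : ℝ => c) a b :=
  ((LipschitzWith.const c).lipschitzOnWith (s := uIcc a b)).absolutelyContinuousOnInterval

theorem absolutelyContinuousOnInterval_sum {σ : Type*} (s : Finset σ) {f : σ → ℝ → F}
    (hf : ∀ i, AbsolutelyContinuousOnInterval (f i) a b) :
    AbsolutelyContinuousOnInterval (fun t => ∑ i ∈ s, f i t) a b := by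
  classical
  induction s using Finset.induction_on with
  | empty => simpa using absolutelyContinuousOnInterval_const (0 : F)
  | insert i s hi ih =>
    simp only [Finset.sum_insert hi]
    exact (hf i).fun_add ih

theorem absolutelyContinuousOnInterval_pi {f : ℝ → ι → F}
    (hf : ∀ i, AbsolutelyContinuousOnInterval (fun t => f t i) a b) :
    AbsolutelyContinuousOnInterval f a b := by
  have h := tendsto_finsetSum Finset.univ fun i _ => hf i
  simp only [Finset.sum_const_zero] at h
  refine squeeze_zero (fun t => Finset.sum_nonneg fun i _ => dist_nonneg) (fun t => ?_) h
  rw [Finset.sum_comm]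
  refine Finset.sum_le_sum fun i _ => ?_
  refine (dist_pi_le_iff (Finset.sum_nonneg fun i _ => dist_nonneg)).2 fun j => ?_
  exact Finset.single_le_sum (f := fun j => dist (f (t.2 i).1 j) (f (t.2 i).2 j))
    (fun _ _ => dist_nonneg) (Finset.mem_univ j)

theorem absolutelyContinuousOnInterval_apply {f : ℝ → ι → F}
    (hf : AbsolutelyContinuousOnInterval f a b) (i : ι) :
    AbsolutelyContinuousOnInterval (fun t => f t i) a b :=
  absolutelyContinuousOnInterval_comp_lipschitz (g := fun v : ι → F => v i)
    (LipschitzWith.eval (α := fun _ : ι => F) i) hf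

theorem absolutelyContinuousOnInterval_dotProduct {f g : ℝ → ι → 𝕜}
    (hf : AbsolutelyContinuousOnInterval f a b) (hg : AbsolutelyContinuousOnInterval g a b) :
    AbsolutelyContinuousOnInterval (fun t => f t ⬝ᵥ g t) a b :=
  absolutelyContinuousOnInterval_sum Finset.univ fun i =>
    (absolutelyContinuousOnInterval_apply hf i).smul (absolutelyContinuousOnInterval_apply hg i)

theorem absolutelyContinuousOnInterval_mulVec {A : ℝ → Matrix κ ι 𝕜} {f : ℝ → ι → 𝕜}
    (hA : ∀ k i, AbsolutelyContinuousOnInterval (fun t => A t k i) a b)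
    (hf : AbsolutelyContinuousOnInterval f a b) :
    AbsolutelyContinuousOnInterval (fun t => A t *ᵥ f t) a b :=
  absolutelyContinuousOnInterval_pi fun k =>
    absolutelyContinuousOnInterval_dotProduct (absolutelyContinuousOnInterval_pi (hA k)) hf

theorem absolutelyContinuousOnInterval_const_mulVec (A : Matrix κ ι 𝕜) {f : ℝ → ι → 𝕜}
    (hf : AbsolutelyContinuousOnInterval f a b) :
    AbsolutelyContinuousOnInterval (fun t => A *ᵥ f t) a b :=
  absolutelyContinuousOnInterval_mulVec
    (fun _ _ => absolutelyContinuousOnInterval_const _) hf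

end AbsolutelyContinuous

/-! ### Derivatives of matrix-vector products and of the matrix exponential. -/

section Derivatives

variable {ι κ : Type*} [Fintype ι] [Fintype κ] {𝕜 : Type*} [RCLike 𝕜]

theorem hasDerivAt_const_mulVec (A : Matrix κ ι 𝕜) {f : ℝ → ι → 𝕜} {f' : ι → 𝕜} {t : ℝ}
    (hf : HasDerivAt f f' t) : HasDerivAt (fun s => A *ᵥ f s) (A *ᵥ f') t :=
  ((A.mulVecLin.restrictScalars ℝ).toContinuousLinearMap.hasFDerivAt).comp_hasDerivAt t hf

theorem hasDerivAt_dotProduct {f g : ℝ → ι → 𝕜} {f' g' : ι → 𝕜} {t : ℝ}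
    (hf : HasDerivAt f f' t) (hg : HasDerivAt g g' t) :
    HasDerivAt (fun s => f s ⬝ᵥ g s) (f' ⬝ᵥ g t + f t ⬝ᵥ g') t := by
  simp only [dotProduct, ← Finset.sum_add_distrib]
  exact HasDerivAt.fun_sum fun i _ => (hasDerivAt_pi.1 hf i).mul (hasDerivAt_pi.1 hg i)

variable [DecidableEq ι]

open scoped Matrix.Norms.Operator in
theorem hasDerivAt_exp_smul_apply (A : Matrix ι ι 𝕜) (t : ℝ) (i j : ι) :
    HasDerivAt (fun s : ℝ => NormedSpace.exp (s • A) i j)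
      ((NormedSpace.exp (t • A) * A) i j) t := by
  have h := hasDerivAt_exp_smul_const (𝕂 := ℝ) A t
  exact ((Matrix.entryLinearMap ℝ 𝕜 i j).toContinuousLinearMap.hasFDerivAt).comp_hasDerivAt t h

theorem hasDerivAt_exp_smul_mulVec (A : Matrix ι ι 𝕜) (v : ι → 𝕜) (t : ℝ) :
    HasDerivAt (fun s : ℝ => NormedSpace.exp (s • A) *ᵥ v)
      ((NormedSpace.exp (t • A) * A) *ᵥ v) t := by
  refine hasDerivAt_pi.2 fun i => ?_
  simp only [mulVec, dotProduct]
  exact HasDerivAt.fun_sum fun j _ => (hasDerivAt_exp_smul_apply A t i j).mul_const (v j)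

theorem contDiff_exp_smul_apply (A : Matrix ι ι 𝕜) (i j : ι) :
    ContDiff ℝ 1 (fun s : ℝ => NormedSpace.exp (s • A) i j) := by
  have hc : ∀ i j, Continuous (fun s : ℝ => NormedSpace.exp (s • A) i j) := fun i j =>
    continuous_iff_continuousAt.2 fun t => (hasDerivAt_exp_smul_apply A t i j).continuousAt
  rw [contDiff_one_iff_deriv]
  refine ⟨fun t => (hasDerivAt_exp_smul_apply A t i j).differentiableAt, ?_⟩
  rw [funext fun t => (hasDerivAt_exp_smul_apply A t i j).deriv]
  simp only [mul_apply]
  exact continuous_finsetSum _ fun k _ => (hc i k).mul continuous_const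

end Derivatives

/-! ### Uniqueness for linear differential and differential-algebraic equations. -/

section Uniqueness

variable {ι : Type*} [Fintype ι] [DecidableEq ι] {𝕜 : Type*} [RCLike 𝕜] {a b : ℝ}

/-- An absolutely continuous solution of `z' = K z` that vanishes initially vanishes. -/
theorem eq_zero_of_linear_ode (hab : a ≤ b) (K : Matrix ι ι 𝕜) {z : ℝ → ι → 𝕜}
    (hz : AbsolutelyContinuousOnInterval z a b)
    (hd : ∀ᵐ t ∂(volume.restrict (Icc a b)), HasDerivAt z (K *ᵥ z t) t) (h0 : z a = 0) :
    ∀ t ∈ Icc a b, z t = 0 := by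
  -- Integrating factor: `W` has derivative zero almost everywhere, and absolute continuity makes it
  -- constant.
  set W : ℝ → ι → 𝕜 := fun t => NormedSpace.exp (t • (-K)) *ᵥ z t with hW
  have hWac : AbsolutelyContinuousOnInterval W a b :=
    absolutelyContinuousOnInterval_mulVec
      (fun k i => (contDiff_exp_smul_apply (-K) k i).contDiffOn.absolutelyContinuousOnInterval) hz
  have hWd : ∀ᵐ t, t ∈ uIcc a b → HasDerivAt W 0 t := by
    rw [uIcc_of_le hab]
    filter_upwards [(ae_restrict_iff' measurableSet_Icc).1 hd] with t ht htm
    refine hasDerivAt_pi.2 fun i => ?_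
    have hrow : HasDerivAt (fun (s : ℝ) (j : ι) => NormedSpace.exp (s • (-K)) i j)
        (fun j => (NormedSpace.exp (t • (-K)) * (-K)) i j) t :=
      hasDerivAt_pi.2 fun j => hasDerivAt_exp_smul_apply (-K) t i j
    have h := hasDerivAt_dotProduct hrow (ht htm)
    refine h.congr_deriv ?_
    change ((NormedSpace.exp (t • (-K)) * (-K)) *ᵥ z t) i +
      (NormedSpace.exp (t • (-K)) *ᵥ (K *ᵥ z t)) i = 0
    simp [mulVec_mulVec, neg_mulVec]
  obtain ⟨c, hc⟩ := hWac.const_of_ae_hasDerivAt_zero hWd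
  intro t ht
  have h1 := hc (x := t) (by rwa [uIcc_of_le hab])
  have h2 := hc (x := a) (by simp)
  have h3 : W t = 0 := by
    rw [h1, ← h2, hW]; simp [h0]
  have hu := Matrix.isUnit_exp (t • (-K))
  have : z t = (NormedSpace.exp (t • (-K)))⁻¹ *ᵥ W t := by
    rw [hW]
    simp only [mulVec_mulVec]
    rw [nonsing_inv_mul _ ((isUnit_iff_isUnit_det _).1 hu), one_mulVec]
  rw [this, h3, mulVec_zero]

theorem eq_zero_of_ae_eq_zero (hab : a < b) {F : Type*} [NormedAddCommGroup F] {z : ℝ → F}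
    (hz : ContinuousOn z (Icc a b)) (h : ∀ᵐ t ∂(volume.restrict (Icc a b)), z t = 0) :
    ∀ t ∈ Icc a b, z t = 0 :=
  Measure.eqOn_Icc_of_ae_eq volume hab.ne h hz continuousOn_const

/-- An absolutely continuous solution of the differential-algebraic equation
`N z' = -(1 - μ N) z` that vanishes initially vanishes. -/
theorem eq_zero_of_linear_dae (hab : a < b) (N : Matrix ι ι 𝕜) (μ : 𝕜) {z z' : ℝ → ι → 𝕜}
    (hz : AbsolutelyContinuousOnInterval z a b)
    (hd : ∀ᵐ t ∂(volume.restrict (Icc a b)), HasDerivAt z (z' t) t)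
    (hN : ∀ᵐ t ∂(volume.restrict (Icc a b)), z t = -(N *ᵥ (z' t - μ • z t)))
    (h0 : z a = 0) : ∀ t ∈ Icc a b, z t = 0 := by
  obtain ⟨hcomm, houter, ν, hν⟩ := drazin_spec N
  set D := drazin N
  -- `D * N` is the projection onto the part where `N` is invertible. Applying `D` to the equation
  -- gives the ordinary equation `p' = (μ - D) p` for `p = D N z`.
  have hp : ∀ t ∈ Icc a b, (D * N) *ᵥ z t = 0 := by
    refine eq_zero_of_linear_ode hab.le (μ • 1 - D)
      (absolutelyContinuousOnInterval_const_mulVec (D * N) hz) ?_ (by simp [h0])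
    filter_upwards [hd, hN] with t hdt hNt
    refine (hasDerivAt_const_mulVec (D * N) hdt).congr_deriv ?_
    have h1 : D *ᵥ z t = -((D * N) *ᵥ z' t) + μ • ((D * N) *ᵥ z t) := by
      conv_lhs => rw [hNt]
      rw [mulVec_neg, mulVec_mulVec, mulVec_sub, mulVec_smul]
      abel
    have h2 : D *ᵥ ((D * N) *ᵥ z t) = D *ᵥ z t := by
      rw [mulVec_mulVec, hcomm, ← Matrix.mul_assoc, houter]
    rw [sub_mulVec, h2, h1, smul_mulVec, one_mulVec]
    abel
  -- On the nilpotent part the power of `N` is lowered one step at a time. The start is `N ^ ν z = N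
  -- ^ ν (D N z) = 0`. If `N ^ (j + 1) z` vanishes identically, so does its derivative, and applying
  -- `N ^ j` to the equation gives `N ^ j z = 0` almost everywhere, hence everywhere by continuity.
  -- At `k = ν` the power is `1`.
  have hq : ∀ k, ∀ t ∈ Icc a b, N ^ (ν - k) *ᵥ z t = 0 := by
    intro k
    induction k with
    | zero =>
      intro t ht
      rw [Nat.sub_zero, ← hν, pow_succ', ← Matrix.mul_assoc, hcomm, Matrix.mul_assoc]
      have : N * (D * N ^ ν) = N ^ ν * (D * N) := by
        have hc : Commute D N := hcomm
        rw [(hc.pow_right ν).eq, ← Matrix.mul_assoc, ← pow_succ', pow_succ, Matrix.mul_assoc,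
          hcomm]
      rw [this, ← mulVec_mulVec, hp t ht, mulVec_zero]
    | succ k ih =>
      -- Truncated subtraction: once the exponent is `0` there is nothing left to lower.
      by_cases hk : ν - k = 0
      · have : ν - (k + 1) = ν - k := by omega
        rwa [this]
      obtain ⟨j, hj⟩ := Nat.exists_eq_succ_of_ne_zero hk
      have hj' : ν - (k + 1) = j := by omega
      rw [hj] at ih
      rw [hj']
      have hc := absolutelyContinuousOnInterval_const_mulVec (N ^ j) hz
      have hc' := hc.continuousOn
      rw [uIcc_of_le hab.le] at hc'
      refine eq_zero_of_ae_eq_zero hab hc' ?_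
      have hoo : ∀ᵐ t ∂(volume.restrict (Icc a b)), t ∈ Ioo a b := by
        rw [← restrict_Ioo_eq_restrict_Icc]
        exact ae_restrict_mem measurableSet_Ioo
      filter_upwards [hd, hN, hoo] with t hdt hNt ht
      have h1 := hasDerivAt_const_mulVec (N ^ (j + 1)) hdt
      have h2 : HasDerivAt (fun s => N ^ (j + 1) *ᵥ z s) 0 t := by
        refine (hasDerivAt_const t (0 : ι → 𝕜)).congr_of_eventuallyEq ?_
        filter_upwards [Icc_mem_nhds ht.1 ht.2] with s hs using ih s hs
      have h3 := h1.unique h2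
      rw [hNt, mulVec_neg, mulVec_mulVec, ← pow_succ, mulVec_sub, mulVec_smul, h3,
        ih t (Ioo_subset_Icc_self ht)]
      simp
  intro t ht
  simpa using hq ν t ht

end Uniqueness

/-! ### Comparison of nonnegative integrals with values in `[0, ∞]`. -/

section Comparison

variable {α : Type*} [MeasurableSpace α] {ρ : Measure α} {f g c h : α → ℝ}

/-- Here `f` is the optimal integrand, `h` that of a competitor, `g` that of the difference and `c`
the cross term. Neither `g` nor `h` need be integrable, so `h` is bounded below by `f + c`, which is
integrable with the same integral as `f`. Since `f + c` may be negative, its positive part is used.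
-/
theorem lintegral_ofReal_le_of_eq_add (hf : Integrable f ρ) (hf0 : 0 ≤ᵐ[ρ] f)
    (hg0 : 0 ≤ᵐ[ρ] g) (hc : Integrable c ρ) (hc0 : ∫ t, c t ∂ρ = 0)
    (hh : ∀ᵐ t ∂ρ, h t = f t + g t + c t) :
    ∫⁻ t, ENNReal.ofReal (f t) ∂ρ ≤ ∫⁻ t, ENNReal.ofReal (h t) ∂ρ := by
  rw [← ofReal_integral_eq_lintegral_ofReal hf hf0]
  by_cases hfin : ∫⁻ t, ENNReal.ofReal (h t) ∂ρ = ⊤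
  · rw [hfin]; exact le_top
  calc ENNReal.ofReal (∫ t, f t ∂ρ) = ENNReal.ofReal (∫ t, (f t + c t) ∂ρ) := by
        rw [integral_add hf hc, hc0, add_zero]
    _ ≤ ENNReal.ofReal (∫ t, max (f t + c t) 0 ∂ρ) := by
        refine ENNReal.ofReal_le_ofReal (integral_mono (hf.add hc) ((hf.add hc).pos_part) ?_)
        exact fun t => le_max_left _ _
    _ = ∫⁻ t, ENNReal.ofReal (max (f t + c t) 0) ∂ρ :=
        ofReal_integral_eq_lintegral_ofReal ((hf.add hc).pos_part)
          (Filter.Eventually.of_forall fun t => le_max_right _ _)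
    _ ≤ ∫⁻ t, ENNReal.ofReal (h t) ∂ρ := by
        refine lintegral_mono_ae ?_
        filter_upwards [hh, hg0] with t ht hgt
        rw [ENNReal.ofReal_max, ENNReal.ofReal_zero, max_eq_left zero_le]
        refine ENNReal.ofReal_le_ofReal ?_
        have : 0 ≤ g t := hgt
        linarith

/-- The equality case: a competitor that is no worse has finite cost, so `h` and with it `g` are
integrable. Then the integral of `g` is at most zero. -/
theorem ae_eq_zero_of_lintegral_ofReal_le (hf : Integrable f ρ) (hf0 : 0 ≤ᵐ[ρ] f)
    (hg0 : 0 ≤ᵐ[ρ] g) (hgm : AEStronglyMeasurable g ρ) (hc : Integrable c ρ)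
    (hc0 : ∫ t, c t ∂ρ = 0) (hh : ∀ᵐ t ∂ρ, h t = f t + g t + c t) (hh0 : 0 ≤ᵐ[ρ] h)
    (hle : ∫⁻ t, ENNReal.ofReal (h t) ∂ρ ≤ ∫⁻ t, ENNReal.ofReal (f t) ∂ρ) :
    g =ᵐ[ρ] 0 := by
  have hfi := ofReal_integral_eq_lintegral_ofReal hf hf0
  have hhm : AEStronglyMeasurable h ρ :=
    ((hf.aestronglyMeasurable.add hgm).add hc.aestronglyMeasurable).congr
      (by filter_upwards [hh] with t ht using ht.symm)
  have hhi : Integrable h ρ := by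
    refine (lintegral_ofReal_ne_top_iff_integrable hhm hh0).1 (ne_top_of_le_ne_top ?_ hle)
    rw [← hfi]; exact ENNReal.ofReal_ne_top
  have hgi : Integrable g ρ := ((hhi.sub hf).sub hc).congr (by
    filter_upwards [hh] with t ht
    simp only [Pi.sub_apply]; linarith)
  have h1 : ∫ t, h t ∂ρ = ∫ t, f t ∂ρ + ∫ t, g t ∂ρ := by
    rw [integral_congr_ae hh, integral_add (f := fun t => f t + g t) (hf.add hgi) hc, integral_add hf hgi, hc0, add_zero]
  rw [← hfi, ← ofReal_integral_eq_lintegral_ofReal hhi hh0,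
    ENNReal.ofReal_le_ofReal_iff (integral_nonneg_of_ae hf0)] at hle
  exact (integral_eq_zero_iff_of_nonneg_ae hg0 hgi).1
    (le_antisymm (by linarith) (integral_nonneg_of_ae hg0))

end Comparison

end PHOCP

namespace PHOCP

/-! ### Block matrix algebra and Schur elimination. -/

section Algebra

variable {ι κ : Type*} [Fintype ι] [Fintype κ] [DecidableEq ι] [DecidableEq κ]

theorem isUnit_fromBlocks_zero₁₁ {K : Type*} [CommRing K] {X Y : Matrix ι ι K}
    (P : Matrix ι ι K) (hX : IsUnit X) (hY : IsUnit Y) : IsUnit (fromBlocks 0 X Y P) := by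
  have hX' := (isUnit_iff_isUnit_det _).1 hX
  have hY' := (isUnit_iff_isUnit_det _).1 hY
  refine IsUnit.of_mul_eq_one (fromBlocks (-(Y⁻¹ * P * X⁻¹)) Y⁻¹ X⁻¹ 0) ?_
  rw [fromBlocks_multiply]
  simp only [Matrix.zero_mul, zero_add, add_zero, Matrix.mul_zero, Matrix.mul_neg,
    ← Matrix.mul_assoc, mul_nonsing_inv _ hX', mul_nonsing_inv _ hY', Matrix.one_mul,
    neg_zero, neg_add_cancel, fromBlocks_one]

/-- Block elimination of `u` from `H z + B u = -s`, `C z + S u = 0`. -/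
theorem schur_elimination {K : Type*} [CommRing K] {H E : Matrix ι ι K} (hHE : H * E = 1)
    (hEH : E * H = 1) (B : Matrix ι κ K) (C : Matrix κ ι K) (S T : Matrix κ κ K)
    (hT : T = S - C * E * B) (hTu : IsUnit T) (z s : ι → K) (u : κ → K) :
    (z = -((E + E * B * T⁻¹ * C * E) *ᵥ s) ∧ u = (T⁻¹ * C * E) *ᵥ s) ↔
      (H *ᵥ z + B *ᵥ u = -s ∧ C *ᵥ z + S *ᵥ u = 0) := by
  have hT' := (isUnit_iff_isUnit_det _).1 hTu
  have hS : S = T + C * E * B := by rw [hT]; abel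
  have hz : ∀ v : κ → K, v = (T⁻¹ * C * E) *ᵥ s →
      (E + E * B * T⁻¹ * C * E) *ᵥ s = E *ᵥ s + E *ᵥ (B *ᵥ v) := by
    rintro v rfl
    rw [add_mulVec]
    simp only [mulVec_mulVec, Matrix.mul_assoc]
  constructor
  · rintro ⟨h1, h2⟩
    rw [hz u h2] at h1
    have h3 : T *ᵥ u = C *ᵥ (E *ᵥ s) := by
      rw [h2, mulVec_mulVec, Matrix.mul_assoc, ← Matrix.mul_assoc T, mul_nonsing_inv _ hT',
        Matrix.one_mul, mulVec_mulVec]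
    constructor
    · rw [h1, mulVec_neg, mulVec_add, mulVec_mulVec, mulVec_mulVec, hHE, one_mulVec, one_mulVec]
      abel
    · rw [hS, add_mulVec, h3, h1, mulVec_neg, mulVec_add]
      simp only [mulVec_mulVec, Matrix.mul_assoc]
      abel
  · rintro ⟨h1, h2⟩
    have h3 : z = -(E *ᵥ s + E *ᵥ (B *ᵥ u)) := by
      have h4 : z = E *ᵥ (H *ᵥ z) := by rw [mulVec_mulVec, hEH, one_mulVec]
      rw [h4, eq_sub_of_add_eq h1, mulVec_sub, mulVec_neg]
      abel
    have h5 : T *ᵥ u = C *ᵥ (E *ᵥ s) := by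
      rw [hS, add_mulVec, h3, mulVec_neg, mulVec_add] at h2
      simp only [mulVec_mulVec, Matrix.mul_assoc] at h2 ⊢
      linear_combination h2
    have h6 : u = (T⁻¹ * C * E) *ᵥ s := by
      rw [Matrix.mul_assoc, ← mulVec_mulVec, ← mulVec_mulVec, ← h5, mulVec_mulVec,
        nonsing_inv_mul _ hT', one_mulVec]
    exact ⟨by rw [hz u h6, h3], h6⟩

end Algebra

/-! ### The optimality pencil and Hermitian quadratic forms. -/

section Pencil

variable {n m : ℕ} {𝕜 : Type*} [RCLike 𝕜]

theorem isUnit_shifted_hamiltonian {A P : Matrix (Fin n) (Fin n) 𝕜} {μ : 𝕜}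
    (hμ₁ : μ ∉ spectrum 𝕜 A) (hμ₂ : μ ∉ spectrum 𝕜 (-Aᴴ)) :
    IsUnit (fromBlocks 0 (A - μ • 1) (Aᴴ + μ • 1) P) := by
  rw [spectrum.notMem_iff, Algebra.algebraMap_eq_smul_one] at hμ₁ hμ₂
  refine isUnit_fromBlocks_zero₁₁ P ?_ ?_
  · rw [← neg_sub]; exact hμ₁.neg
  · rwa [sub_neg_eq_add, add_comm] at hμ₂

/-- Up to sign, the shifted pencil is a block matrix whose upper left block is the inverse of `E_μ`,
and `S_μ` is the Schur complement of that block. -/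
theorem isUnit_Smu {J R Q : Matrix (Fin n) (Fin n) 𝕜} {B : Matrix (Fin n) (Fin m) 𝕜}
    {S : Matrix (Fin m) (Fin m) 𝕜} {μ : 𝕜}
    (hμ₁ : μ ∉ spectrum 𝕜 ((J - R) * Q)) (hμ₂ : μ ∉ spectrum 𝕜 (-((J - R) * Q)ᴴ))
    (hreg : IsUnit (μ • pencilE n m 𝕜 - pencilA J R Q B S)) : IsUnit (Smu J R Q B S μ) := by
  have hH := isUnit_shifted_hamiltonian (P := Q * R * Q) hμ₁ hμ₂
  have key : -(μ • pencilE n m 𝕜 - pencilA J R Q B S) =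
      fromBlocks (fromBlocks 0 ((J - R) * Q - μ • 1) (((J - R) * Q)ᴴ + μ • 1) (Q * R * Q))
        (fromRows B 0) (fromCols Bᴴ 0) S := by
    rw [pencilE, pencilA, neg_sub, fromBlocks_smul, fromBlocks_smul, sub_eq_add_neg,
      fromBlocks_neg, fromBlocks_neg, fromBlocks_add, fromBlocks_add]
    simp [sub_eq_add_neg]
  have h := hreg.neg
  rw [key] at h
  let := hH.invertible
  rw [isUnit_fromBlocks_iff_of_invertible₁₁, invOf_eq_nonsing_inv] at h
  exact h

/-- The linear relations `z = -N y`, `u = -M y` are equivalent to the shifted optimality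
system. -/
theorem optimality_system_iff {J R Q : Matrix (Fin n) (Fin n) 𝕜} {B : Matrix (Fin n) (Fin m) 𝕜}
    {S : Matrix (Fin m) (Fin m) 𝕜} {μ : 𝕜}
    (hμ₁ : μ ∉ spectrum 𝕜 ((J - R) * Q)) (hμ₂ : μ ∉ spectrum 𝕜 (-((J - R) * Q)ᴴ))
    (hreg : IsUnit (μ • pencilE n m 𝕜 - pencilA J R Q B S))
    (l x p q : Fin n → 𝕜) (u : Fin m → 𝕜) :
    (Sum.elim l x = -(Nmu J R Q B S μ *ᵥ (Sum.elim p q - μ • Sum.elim l x)) ∧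
      u = -(Mmu J R Q B S μ *ᵥ (Sum.elim p q - μ • Sum.elim l x))) ↔
    (q = ((J - R) * Q) *ᵥ x + B *ᵥ u ∧ p = -(((J - R) * Q)ᴴ *ᵥ l + (Q * R * Q) *ᵥ x) ∧
      Bᴴ *ᵥ l + S *ᵥ u = 0) := by
  have hH := (isUnit_iff_isUnit_det _).1
    (isUnit_shifted_hamiltonian (P := Q * R * Q) hμ₁ hμ₂)
  have h := schur_elimination (mul_nonsing_inv _ hH) (nonsing_inv_mul _ hH)
    (fromRows B 0 : Matrix (Fin n ⊕ Fin n) (Fin m) 𝕜)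
    (fromCols Bᴴ 0 : Matrix (Fin m) (Fin n ⊕ Fin n) 𝕜) S (Smu J R Q B S μ) rfl
    (isUnit_Smu hμ₁ hμ₂ hreg) (Sum.elim l x)
    (symp n 𝕜 *ᵥ (Sum.elim p q - μ • Sum.elim l x)) u
  have hN : Nmu J R Q B S μ *ᵥ (Sum.elim p q - μ • Sum.elim l x) = (Emu J R Q μ + Emu J R Q μ *
      (fromRows B 0 : Matrix (Fin n ⊕ Fin n) (Fin m) 𝕜) * (Smu J R Q B S μ)⁻¹ *
      (fromCols Bᴴ 0 : Matrix (Fin m) (Fin n ⊕ Fin n) 𝕜) * Emu J R Q μ) *ᵥ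
        (symp n 𝕜 *ᵥ (Sum.elim p q - μ • Sum.elim l x)) := by
    rw [mulVec_mulVec]; rfl
  have hM : -(Mmu J R Q B S μ *ᵥ (Sum.elim p q - μ • Sum.elim l x)) = ((Smu J R Q B S μ)⁻¹ *
      (fromCols Bᴴ 0 : Matrix (Fin m) (Fin n ⊕ Fin n) 𝕜) * Emu J R Q μ) *ᵥ
        (symp n 𝕜 *ᵥ (Sum.elim p q - μ • Sum.elim l x)) := by
    rw [mulVec_mulVec, Mmu, neg_mulVec, neg_neg]
  rw [hN, hM]
  refine h.trans ?_
  have hs : Sum.elim p q - μ • Sum.elim l x = Sum.elim (p - μ • l) (q - μ • x) := by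
    ext (i | i) <;> simp
  rw [hs, symp, fromBlocks_mulVec, fromBlocks_mulVec, fromRows_mulVec, fromCols_mulVec]
  simp only [Sum.elim_comp_inl, Sum.elim_comp_inr, zero_mulVec, one_mulVec, neg_mulVec, zero_add,
    add_zero, sub_mulVec, add_mulVec, smul_mulVec]
  rw [← and_assoc]
  refine and_congr_left fun _ => ?_
  rw [← Sum.elim_neg_neg, ← Sum.elim_add_add, Sum.elim_eq_iff, neg_neg]
  -- The symplectic unit sends `(p, q)` to `(-q, p)`, so the first block row is the dynamics and the
  -- second the adjoint equation. The shifts by `μ` cancel on both sides.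
  refine and_congr ⟨fun h => ?_, fun h => ?_⟩ ⟨fun h => ?_, fun h => ?_⟩
  · linear_combination -h
  · linear_combination -h
  · linear_combination h
  · linear_combination h

theorem re_quadratic_add {k : ℕ} {P : Matrix (Fin k) (Fin k) 𝕜} (hP : P.IsHermitian)
    (x d : Fin k → 𝕜) :
    RCLike.re (star (x + d) ⬝ᵥ (P *ᵥ (x + d))) = RCLike.re (star x ⬝ᵥ (P *ᵥ x)) +
      RCLike.re (star d ⬝ᵥ (P *ᵥ d)) + 2 * RCLike.re (star d ⬝ᵥ (P *ᵥ x)) := by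
  have h : RCLike.re (star x ⬝ᵥ (P *ᵥ d)) = RCLike.re (star d ⬝ᵥ (P *ᵥ x)) := by
    rw [← RCLike.conj_re (star x ⬝ᵥ (P *ᵥ d)), ← RCLike.star_def, star_dotProduct, star_star,
      star_mulVec, hP.eq, ← dotProduct_mulVec]
  rw [star_add, mulVec_add, add_dotProduct, dotProduct_add, dotProduct_add]
  simp only [map_add]
  rw [h]
  ring

theorem re_quadratic_nonneg {k : ℕ} {P : Matrix (Fin k) (Fin k) 𝕜} (hP : P.PosSemidef)
    (x : Fin k → 𝕜) : 0 ≤ RCLike.re (star x ⬝ᵥ (P *ᵥ x)) :=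
  (RCLike.nonneg_iff.1 (hP.dotProduct_mulVec_nonneg x)).1

/-- The form is real for semidefinite `P`, so its real part determines it. -/
theorem mulVec_eq_zero_of_re_quadratic {k : ℕ} {P : Matrix (Fin k) (Fin k) 𝕜}
    (hP : P.PosSemidef) {x : Fin k → 𝕜} (h : RCLike.re (star x ⬝ᵥ (P *ᵥ x)) = 0) :
    P *ᵥ x = 0 := by
  refine (hP.dotProduct_mulVec_zero_iff x).1 (RCLike.ext ?_ ?_)
  · simpa using h
  · simpa using (RCLike.nonneg_iff.1 (hP.dotProduct_mulVec_nonneg x)).2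

theorem continuous_re_quadratic {k : ℕ} (P : Matrix (Fin k) (Fin k) 𝕜) :
    Continuous fun x : Fin k → 𝕜 => RCLike.re (star x ⬝ᵥ (P *ᵥ x)) := by
  fun_prop

end Pencil

end PHOCP

namespace PHOCP

/-! ### Consistent flows, sufficiency of the adjoint equations, and uniqueness of the control. -/

section Optimality

variable {n m : ℕ} {𝕜 : Type*} [RCLike 𝕜]

theorem IsPortHamiltonian.posSemidef_QRQ {J R Q : Matrix (Fin n) (Fin n) 𝕜}
    (h : IsPortHamiltonian J R Q) : (Q * R * Q).PosSemidef := by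
  have := h.dissipation.conjTranspose_mul_mul_same Q
  rwa [h.energy.isHermitian.eq] at this

/-- For consistent initial values `w`, the curve `z = flow · w` solves `N z' = -(1 - μ N) z`, and
`z' - μ z = -N^D z`. -/
theorem flow_mulVec_spec (N : Matrix (Fin n ⊕ Fin n) (Fin n ⊕ Fin n) 𝕜) (μ : 𝕜) (t₀ : ℝ)
    {w : Fin n ⊕ Fin n → 𝕜} (hw : w ∈ LinearMap.range (drazin N * N).mulVecLin) (t : ℝ) :
    ∃ z' : Fin n ⊕ Fin n → 𝕜,
      HasDerivAt (fun s => flow N μ (s - t₀) *ᵥ w) z' t ∧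
      z' - μ • (flow N μ (t - t₀) *ᵥ w) = -((drazin N * flow N μ (t - t₀)) *ᵥ w) ∧
      flow N μ (t - t₀) *ᵥ w = -(N *ᵥ (z' - μ • (flow N μ (t - t₀) *ᵥ w))) := by
  obtain ⟨hcomm, houter, -⟩ := drazin_spec N
  have hDN : Commute (drazin N) N := hcomm
  have hcX : ∀ Y, Commute Y (drazin N) → Commute Y N → Commute Y (flow N μ (t - t₀)) := by
    intro Y h1 h2
    refine Commute.exp_right (Commute.smul_right (Commute.neg_right ?_) _)
    exact h1.mul_right ((Commute.one_right Y).sub_right (h2.smul_right μ))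
  have hcD := hcX _ (Commute.refl _) hDN
  have hcN := hcX _ hDN.symm (Commute.refl _)
  -- Consistency of `w` enters here: it is fixed by the projection `N^D N`, so the generator `-N^D +
  -- μ N^D N` acts on it as `μ - N^D`.
  have hpw : (drazin N * N) *ᵥ w = w := by
    obtain ⟨v, rfl⟩ := hw
    rw [mulVecLin_apply, mulVec_mulVec, ← Matrix.mul_assoc, houter]
  have hd := (hasDerivAt_exp_smul_mulVec (-(drazin N * (1 - μ • N))) w (t - t₀)).comp_sub_const t t₀
  have hy : (flow N μ (t - t₀) * -(drazin N * (1 - μ • N))) *ᵥ w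
      - μ • (flow N μ (t - t₀) *ᵥ w) = -((drazin N * flow N μ (t - t₀)) *ᵥ w) := by
    rw [← mulVec_mulVec, neg_mulVec, Matrix.mul_sub, Matrix.mul_one, sub_mulVec, Matrix.mul_smul,
      smul_mulVec, hpw, hcD.eq, ← mulVec_mulVec, mulVec_neg, mulVec_sub, mulVec_smul]
    abel
  refine ⟨_, hd, hy, ?_⟩
  change _ = -(N *ᵥ ((flow N μ (t - t₀) * -(drazin N * (1 - μ • N))) *ᵥ w - _))
  rw [hy, mulVec_neg, neg_neg, mulVec_mulVec, ← Matrix.mul_assoc, ← hcomm,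
    (hcD.mul_left hcN).eq, ← mulVec_mulVec, hpw]

variable {J R Q : Matrix (Fin n) (Fin n) 𝕜} {B : Matrix (Fin n) (Fin m) 𝕜}
  {S : Matrix (Fin m) (Fin m) 𝕜} {t₀ t₁ : ℝ} {x₀ x₁ : Fin n → 𝕜}
  {x x' l : ℝ → Fin n → 𝕜} {u u' : ℝ → Fin m → 𝕜}

theorem IsAdmissible.continuousOn (h : IsAdmissible J R Q B t₀ t₁ x₀ x₁ x u) (ht : t₀ < t₁) :
    ContinuousOn x (Icc t₀ t₁) := by
  have := h.state_ac.continuousOn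
  rwa [uIcc_of_le ht.le] at this

/-- Comparison of an admissible pair satisfying the adjoint equations with an arbitrary admissible
pair. -/
theorem cost_comparison (hJRQ : IsPortHamiltonian J R Q) (hS : S.PosSemidef) (ht : t₀ < t₁)
    (hx : IsAdmissible J R Q B t₀ t₁ x₀ x₁ x u) (hu : ContinuousOn u (Icc t₀ t₁))
    (hlac : AbsolutelyContinuousOnInterval l t₀ t₁)
    (hl : ∀ᵐ t ∂(volume.restrict (Icc t₀ t₁)),
      HasDerivAt l (-(((J - R) * Q)ᴴ *ᵥ l t + (Q * R * Q) *ᵥ x t)) t)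
    (hlu : ∀ t ∈ Icc t₀ t₁, Bᴴ *ᵥ l t + S *ᵥ u t = 0)
    (hx' : IsAdmissible J R Q B t₀ t₁ x₀ x₁ x' u') :
    cost R Q S t₀ t₁ x u ≤ cost R Q S t₀ t₁ x' u' ∧
      (cost R Q S t₀ t₁ x' u' ≤ cost R Q S t₀ t₁ x u →
        ∀ᵐ t ∂(volume.restrict (Icc t₀ t₁)),
          (Q * R * Q) *ᵥ (x' t - x t) = 0 ∧ S *ᵥ (u' t - u t) = 0) := by
  have hP := hJRQ.posSemidef_QRQ
  set P := Q * R * Q with hPdef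
  set A := (J - R) * Q with hA
  set L : (ℝ → Fin n → 𝕜) → (ℝ → Fin m → 𝕜) → ℝ → ℝ := fun y v t =>
    (1 / 2 : ℝ) * RCLike.re (star (y t) ⬝ᵥ (P *ᵥ y t) + star (v t) ⬝ᵥ (S *ᵥ v t)) with hL
  have hL0 : ∀ y v t, 0 ≤ L y v t := by
    intro y v t
    simp only [hL, map_add]
    have := re_quadratic_nonneg hP (y t)
    have := re_quadratic_nonneg hS (v t)
    positivity
  have hxc := hx.continuousOn ht
  have hxc' := hx'.continuousOn ht
  have hf : Integrable (L x u) (volume.restrict (Icc t₀ t₁)) := by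
    refine ContinuousOn.integrableOn_Icc ?_
    simp only [hL, map_add]
    exact continuousOn_const.mul (((continuous_re_quadratic P).comp_continuousOn hxc).add
      ((continuous_re_quadratic S).comp_continuousOn hu))
  have hgm : AEStronglyMeasurable (L (x' - x) (u' - u)) (volume.restrict (Icc t₀ t₁)) := by
    simp only [hL, map_add]
    refine AEStronglyMeasurable.const_mul (AEStronglyMeasurable.add ?_ ?_) _
    · exact (continuous_re_quadratic P).comp_aestronglyMeasurable
        ((hxc'.sub hxc).aestronglyMeasurable measurableSet_Icc)
    · exact (continuous_re_quadratic S).comp_aestronglyMeasurable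
        (hx'.control_integrable.aestronglyMeasurable.sub hx.control_integrable.aestronglyMeasurable)
  -- the adjoint pairing
  set h : ℝ → ℝ := fun t => RCLike.re (star (x' t - x t) ⬝ᵥ l t) with hh
  have hhac : AbsolutelyContinuousOnInterval h t₀ t₁ := by
    have h1 : AbsolutelyContinuousOnInterval (fun t => star (x' t - x t)) t₀ t₁ :=
      absolutelyContinuousOnInterval_clm
        (starL' ℝ : (Fin n → 𝕜) ≃L[ℝ] (Fin n → 𝕜)).toContinuousLinearMap
        (hx'.state_ac.fun_sub hx.state_ac)
    exact absolutelyContinuousOnInterval_clm (RCLike.reCLM (K := 𝕜))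
      (absolutelyContinuousOnInterval_dotProduct h1 hlac)
  have hhd : ∀ᵐ t ∂(volume.restrict (Icc t₀ t₁)), deriv h t =
      -RCLike.re (star (x' t - x t) ⬝ᵥ (P *ᵥ x t) + star (u' t - u t) ⬝ᵥ (S *ᵥ u t)) := by
    filter_upwards [hx.dynamics, hx'.dynamics, hl, ae_restrict_mem measurableSet_Icc] with
      t h1 h2 h3 htm
    have h4 := hasDerivAt_dotProduct (h2.sub h1).star h3
    have h5 : HasDerivAt h _ t :=
      (RCLike.reCLM (K := 𝕜)).hasFDerivAt.comp_hasDerivAt t h4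
    rw [h5.deriv, RCLike.reCLM_apply, ← map_neg]
    congr 1
    have h6 : S *ᵥ u t = -(Bᴴ *ᵥ l t) := eq_neg_of_add_eq_zero_right (hlu t htm)
    have h7 : (A *ᵥ x' t + B *ᵥ u' t - (A *ᵥ x t + B *ᵥ u t)) =
        A *ᵥ (x' t - x t) + B *ᵥ (u' t - u t) := by
      rw [mulVec_sub, mulVec_sub]; abel
    rw [h6, h7]
    simp only [Pi.sub_apply, star_add, star_mulVec, add_dotProduct, dotProduct_neg, dotProduct_add,
      ← dotProduct_mulVec]
    ring
  have hc : Integrable (fun t => -deriv h t) (volume.restrict (Icc t₀ t₁)) := by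
    have := hhac.intervalIntegrable_deriv
    rw [intervalIntegrable_iff_integrableOn_Icc_of_le ht.le] at this
    exact this.neg
  have hc0 : ∫ t in Icc t₀ t₁, -deriv h t = 0 := by
    rw [integral_neg, integral_Icc_eq_integral_Ioc, ← intervalIntegral.integral_of_le ht.le,
      hhac.integral_deriv_eq_sub]
    -- Both states share their boundary values, so `h` vanishes at both ends.
    simp [hh, hx.initial, hx'.initial, hx.terminal, hx'.terminal]
  have hsum : ∀ᵐ t ∂(volume.restrict (Icc t₀ t₁)),
      L x' u' t = L x u t + L (x' - x) (u' - u) t + -deriv h t := by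
    filter_upwards [hhd] with t h1
    have h2 := re_quadratic_add hP.isHermitian (x t) (x' t - x t)
    have h3 := re_quadratic_add hS.isHermitian (u t) (u' t - u t)
    rw [add_sub_cancel] at h2 h3
    rw [h1]
    simp only [hL, map_add, h2, h3, Pi.sub_apply]
    ring
  have hnn : ∀ y v, 0 ≤ᵐ[volume.restrict (Icc t₀ t₁)] L y v := fun y v =>
    Filter.Eventually.of_forall (hL0 y v)
  refine ⟨lintegral_ofReal_le_of_eq_add hf (hnn _ _) (hnn _ _) hc hc0 hsum, fun hle => ?_⟩
  filter_upwards [ae_eq_zero_of_lintegral_ofReal_le hf (hnn _ _) (hnn _ _) hgm hc hc0 hsum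
    (hnn _ _) hle] with t h1
  simp only [hL, map_add, Pi.sub_apply, Pi.zero_apply] at h1
  have h2 := re_quadratic_nonneg hP (x' t - x t)
  have h3 := re_quadratic_nonneg hS (u' t - u t)
  exact ⟨mulVec_eq_zero_of_re_quadratic hP (by linarith),
    mulVec_eq_zero_of_re_quadratic hS (by linarith)⟩

/-- Regularity of the optimality pencil: a pair of admissible pairs whose difference is not seen by
the cost has the same control. -/
theorem control_ae_eq_of_regular {μ : 𝕜} (ht : t₀ < t₁)
    (hμ₁ : μ ∉ spectrum 𝕜 ((J - R) * Q)) (hμ₂ : μ ∉ spectrum 𝕜 (-((J - R) * Q)ᴴ))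
    (hreg : IsUnit (μ • pencilE n m 𝕜 - pencilA J R Q B S))
    (hx : IsAdmissible J R Q B t₀ t₁ x₀ x₁ x u) (hx' : IsAdmissible J R Q B t₀ t₁ x₀ x₁ x' u')
    (h0 : ∀ᵐ t ∂(volume.restrict (Icc t₀ t₁)),
      (Q * R * Q) *ᵥ (x' t - x t) = 0 ∧ S *ᵥ (u' t - u t) = 0) :
    ∀ᵐ t ∂(volume.restrict (Icc t₀ t₁)), u' t = u t := by
  set d : ℝ → Fin n → 𝕜 := fun t =>
    ((J - R) * Q) *ᵥ (x' t - x t) + B *ᵥ (u' t - u t) with hd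
  -- With zero multiplier the adjoint and stationarity equations reduce exactly to the two
  -- conditions in `h0`.
  set z : ℝ → Fin n ⊕ Fin n → 𝕜 := fun t => Sum.elim (0 : Fin n → 𝕜) (x' t - x t) with hz
  set z' : ℝ → Fin n ⊕ Fin n → 𝕜 := fun t => Sum.elim (0 : Fin n → 𝕜) (d t) with hz'
  have hsys : ∀ᵐ t ∂(volume.restrict (Icc t₀ t₁)),
      z t = -(Nmu J R Q B S μ *ᵥ (z' t - μ • z t)) ∧
        u' t - u t = -(Mmu J R Q B S μ *ᵥ (z' t - μ • z t)) := by
    filter_upwards [h0] with t h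
    refine (optimality_system_iff hμ₁ hμ₂ hreg 0 (x' t - x t) 0 (d t) (u' t - u t)).2
      ⟨rfl, ?_, ?_⟩
    · simp [h.1]
    · simp [h.2]
  have hzac : AbsolutelyContinuousOnInterval z t₀ t₁ := by
    refine absolutelyContinuousOnInterval_pi fun i => ?_
    rcases i with i | i
    · exact absolutelyContinuousOnInterval_const _
    · exact absolutelyContinuousOnInterval_apply (hx'.state_ac.fun_sub hx.state_ac) i
  have hzd : ∀ᵐ t ∂(volume.restrict (Icc t₀ t₁)), HasDerivAt z (z' t) t := by
    filter_upwards [hx.dynamics, hx'.dynamics] with t h1 h2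
    refine hasDerivAt_pi.2 fun i => ?_
    rcases i with i | i
    · exact hasDerivAt_const _ _
    · refine (hasDerivAt_pi.1 (h2.sub h1) i).congr_deriv ?_
      simp only [hz', hd, Sum.elim_inr, mulVec_sub, Pi.add_apply, Pi.sub_apply]
      ring
  have hz0 := eq_zero_of_linear_dae ht _ μ hzac hzd (hsys.mono fun t h => h.1)
    (by
      ext (i | i)
      · rfl
      · simp [hz, hx.initial, hx'.initial])
  have hoo : ∀ᵐ t ∂(volume.restrict (Icc t₀ t₁)), t ∈ Ioo t₀ t₁ := by
    rw [← restrict_Ioo_eq_restrict_Icc]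
    exact ae_restrict_mem measurableSet_Ioo
  filter_upwards [hsys, hzd, hoo] with t h1 h2 h3
  -- Since `z` vanishes on the whole interval, so does its derivative at interior points, and `u' -
  -- u = -M (z' - μ z)` is zero.
  have h4 : HasDerivAt z 0 t := by
    refine (hasDerivAt_const t (0 : Fin n ⊕ Fin n → 𝕜)).congr_of_eventuallyEq ?_
    filter_upwards [Icc_mem_nhds h3.1 h3.2] with s hs using hz0 s hs
  have h5 := h1.2
  rw [h2.unique h4, hz0 t (Ioo_subset_Icc_self h3)] at h5
  simpa [sub_eq_zero] using h5

end Optimality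

end PHOCP

/-! ### The main theorem. -/

theorem mainTheorem11 {𝕜 : Type*} [RCLike 𝕜] {n m : ℕ}
    (J R Q : Matrix (Fin n) (Fin n) 𝕜) (B : Matrix (Fin n) (Fin m) 𝕜)
    (S : Matrix (Fin m) (Fin m) 𝕜)
    (hJRQ : PHOCP.IsPortHamiltonian J R Q) (hS : S.PosSemidef)
    (t₀ t₁ : ℝ) (ht : t₀ < t₁) (x₀ x₁ : Fin n → 𝕜) (μ : 𝕜)
    (hμ₁ : μ ∉ spectrum 𝕜 ((J - R) * Q)) (hμ₂ : μ ∉ spectrum 𝕜 (-((J - R) * Q)ᴴ))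
    (hreg : IsUnit (μ • PHOCP.pencilE n m 𝕜 - PHOCP.pencilA J R Q B S))
    (N : Matrix (Fin n ⊕ Fin n) (Fin n ⊕ Fin n) 𝕜) (hN : N = PHOCP.Nmu J R Q B S μ)
    (M : Matrix (Fin m) (Fin n ⊕ Fin n) 𝕜) (hM : M = PHOCP.Mmu J R Q B S μ)
    (E₁ E₂ E₃ E₄ : ℝ → Matrix (Fin n) (Fin n) 𝕜)
    (hE : ∀ t, PHOCP.flow N μ (t - t₀) = fromBlocks (E₁ t) (E₂ t) (E₃ t) (E₄ t))
    (hE₃ : IsUnit (E₃ t₁))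
    (w₀ : Fin n ⊕ Fin n → 𝕜) (hw₀ : w₀ = Sum.elim ((E₃ t₁)⁻¹ *ᵥ (x₁ - E₄ t₁ *ᵥ x₀)) x₀)
    (hbc : w₀ ∈ LinearMap.range (PHOCP.drazin N * N).mulVecLin)
    (u : ℝ → Fin m → 𝕜)
    (hu : ∀ t ∈ Icc t₀ t₁, u t = (M * PHOCP.drazin N * PHOCP.flow N μ (t - t₀)) *ᵥ w₀) :
    PHOCP.IsOptimalControl J R Q B S t₀ t₁ x₀ x₁ u ∧
      ∀ v : ℝ → Fin m → 𝕜, PHOCP.IsOptimalControl J R Q B S t₀ t₁ x₀ x₁ v →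
        ∀ᵐ t ∂(volume.restrict (Icc t₀ t₁)), v t = u t := by
  set z : ℝ → Fin n ⊕ Fin n → 𝕜 := fun t => PHOCP.flow N μ (t - t₀) *ᵥ w₀ with hz
  set l : ℝ → Fin n → 𝕜 := fun t => z t ∘ Sum.inl with hl
  set x : ℝ → Fin n → 𝕜 := fun t => z t ∘ Sum.inr with hx
  choose z' hzd hz'y hz'N using PHOCP.flow_mulVec_spec N μ t₀ hbc
  have hzac : AbsolutelyContinuousOnInterval z t₀ t₁ := by
    refine PHOCP.absolutelyContinuousOnInterval_mulVec (fun k i => ?_)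
      (PHOCP.absolutelyContinuousOnInterval_const w₀)
    exact ((PHOCP.contDiff_exp_smul_apply _ k i).comp
      (contDiff_id.sub contDiff_const)).contDiffOn.absolutelyContinuousOnInterval
  have hld : ∀ t, HasDerivAt l (z' t ∘ Sum.inl) t := fun t =>
    hasDerivAt_pi.2 fun i => hasDerivAt_pi.1 (hzd t) (Sum.inl i)
  have hxd : ∀ t, HasDerivAt x (z' t ∘ Sum.inr) t := fun t =>
    hasDerivAt_pi.2 fun i => hasDerivAt_pi.1 (hzd t) (Sum.inr i)
  have hzc : Continuous z := continuous_iff_continuousAt.2 fun t => (hzd t).continuousAt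
  have hsys : ∀ t ∈ Icc t₀ t₁, z' t ∘ Sum.inr = ((J - R) * Q) *ᵥ x t + B *ᵥ u t ∧
      z' t ∘ Sum.inl = -(((J - R) * Q)ᴴ *ᵥ l t + (Q * R * Q) *ᵥ x t) ∧
      Bᴴ *ᵥ l t + S *ᵥ u t = 0 := by
    intro t htm
    refine (PHOCP.optimality_system_iff hμ₁ hμ₂ hreg (l t) (x t) _ _ (u t)).1 ?_
    simp only [hl, hx, Sum.elim_comp_inl_inr, ← hN, ← hM]
    refine ⟨hz'N t, ?_⟩
    -- `z' - μ z = -N^D z` turns `-M (z' - μ z)` into the prescribed control `M N^D z`.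
    rw [hu t htm, hz, hz'y t, mulVec_neg, neg_neg, mulVec_mulVec, Matrix.mul_assoc]
  have huc : ContinuousOn u (Icc t₀ t₁) := by
    have h1 : Continuous fun t => (M * PHOCP.drazin N) *ᵥ z t := by fun_prop
    refine h1.continuousOn.congr fun t htm => ?_
    simp only [hu t htm, hz, mulVec_mulVec]
  have hzt₀ : z t₀ = w₀ := by
    simp [hz, PHOCP.flow]
  have hadm : PHOCP.IsAdmissible J R Q B t₀ t₁ x₀ x₁ x u := by
    refine ⟨PHOCP.absolutelyContinuousOnInterval_pi fun i =>
      PHOCP.absolutelyContinuousOnInterval_apply hzac (Sum.inr i), huc.integrableOn_Icc, ?_, ?_, ?_⟩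
    · filter_upwards [ae_restrict_mem measurableSet_Icc] with t htm
      rw [← (hsys t htm).1]
      exact hxd t
    · simp only [hx, hzt₀, hw₀, Sum.elim_comp_inr]
    -- The lower block row at `t₁` is `E₃ E₃⁻¹ (x₁ - E₄ x₀) + E₄ x₀ = x₁`, which is why `w₀` has its
    -- upper block.
    · simp only [hx, hz, hE, hw₀, fromBlocks_mulVec, Sum.elim_comp_inr, Sum.elim_comp_inl]
      rw [mulVec_mulVec, mul_nonsing_inv _ ((isUnit_iff_isUnit_det _).1 hE₃), one_mulVec,
        sub_add_cancel]
  have hcmp := fun (y : ℝ → Fin n → 𝕜) (v : ℝ → Fin m → 𝕜)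
      (hy : PHOCP.IsAdmissible J R Q B t₀ t₁ x₀ x₁ y v) =>
    PHOCP.cost_comparison (l := l) hJRQ hS ht hadm huc
      (PHOCP.absolutelyContinuousOnInterval_pi fun i =>
        PHOCP.absolutelyContinuousOnInterval_apply hzac (Sum.inl i))
      (by
        filter_upwards [ae_restrict_mem measurableSet_Icc] with t htm
        rw [← (hsys t htm).2.1]
        exact hld t)
      (fun t htm => (hsys t htm).2.2) hy
  refine ⟨⟨x, hadm, fun y v hy => (hcmp y v hy).1⟩, ?_⟩
  rintro v ⟨y, hy, hmin⟩
  exact PHOCP.control_ae_eq_of_regular ht hμ₁ hμ₂ hreg hadm hy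
    ((hcmp y v hy).2 (hmin x u hadm))
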